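/- Let $X$ be a finite set and let $S: X\times X\to X\times X$, $S(x,y)=(g_x(y),f_y(x))$, be a non-degenerate symmetric set-theoretic solution of the Yang–Baxter equation: all maps $f_x,g_x:X\to X$ are bijective, $S\circ S=\mathrm{Id}$, and $S^{12}S^{23}S^{12}=S^{23}S^{12}S^{23}$ on $X^3$. Let $G(X,S)$ be the group, and $M(X,S)$ the monoid, presented by $\langle X\mid xy=g_x(y)f_y(x)\ ;\ x,y\in X,\ S(x,y)\neq(x,y)\rangle$. Let $V$ be a real vector space with basis $X$, let $\psi:G(X,S)\to GL(V)$ be the representation with $\psi_x(y)=f_x^{-1}(y)$ for $y\in X$, $y\neq x$, and $\psi_x(x)=-f_x^{-1}(x)$, and put $W(X,S)=\psi(G(X,S))$ and $\mathbf X=\{\psi_x\mid x\in X\}$. *Terminology.* A Garside element of a monoid $M$ is an element whose sets of left and right divisors coincide and generate $M$; *the* Garside element is the least one for both left and right divisibility. For a group $W$ generated as a monoid by a subset $\mathbf X$, let $\ell(w)$ be the minimal length of a word on $\mathbf X$ representing $w$. If $w=uv$ with $\ell(w)=\ell(u)+\ell(v)$, then $u$ is a left $\mathbf X$-factor and $v$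 a right $\mathbf X$-factor of $w$; the element $w$ is $\mathbf X$-balanced if its sets of left and right $\mathbf X$-factors coincide, and this set is then denoted by $[1,w]$. For an $\mathbf X$-balanced $w$, the monoid $M_{w,\mathbf X}$ is generated by a copy $\{\underline v\mid v\in[1,w]\}$ of $[1,w]$, with the relations $\underline 1=1$, and $\underline v\,\underline{v'}=\underline{v''}$ whenever $v,v',v''\in[1,w]$, $vv'=v''$ and $\ell(v)+\ell(v')=\ell(v'')$. The pair $(W,\mathbf X)$ is a generating generated group for a monoid $M$, by means of $w$, if $W$ is finite, $\mathbf X$ generates $W$ as a monoid, $w\in W$ is $\mathbf X$-balanced, $[1,w]$ generates $W$, and $M\cong M_{w,\mathbf X}$. *Statement.* $W(X,S)$ is a finite quotient of $G(X,S)$, via $\psi$, and $(W(X,S),\mathbf X)$ is a generating generated group for $M(X,S)$. More precisely, $M(X,S)$ has a unique Garside element $\Delta$ that is least for both left and right divisibility, and $(W(X,S),\mathbf X)$ is a generating generated group for $M(X,S)$ by means of $\psi(\Delta)$; that is, $\psi(\Delta)$ is $\mathbf X$-balanced, $[1,\psi(\Delta)]$ generates $W(X,S)$, and $M_{\psi(\Delta),\mathbf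 X}\cong M(X,S)$. -/

import Mathlib

noncomputable section

namespace YangBaxter

/-! ### Garside elements of a monoid -/

section Garside

variable {M : Type*} [Monoid M]

/-- `f` is a left divisor of `g`. -/
def LeftDivides (f g : M) : Prop := ∃ h, g = f * h

/-- `f` is a right divisor of `g`. -/
def RightDivides (f g : M) : Prop := ∃ h, g = h * f

/-- A Garside element: its left and right divisors coincide and they generate the monoid. -/
structure IsGarsideElement (Δ : M) : Prop where
  balanced : {f | LeftDivides f Δ} = {f | RightDivides f Δ}
  generates : Submonoid.closure {f | LeftDivides f Δ} = ⊤

/-- The Garside element: the least Garside element, for both left and right divisibility. -/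
structure IsTheGarsideElement (Δ : M) : Prop where
  isGarside : IsGarsideElement Δ
  least_left : ∀ Δ', IsGarsideElement Δ' → LeftDivides Δ Δ'
  least_right : ∀ Δ', IsGarsideElement Δ' → RightDivides Δ Δ'

end Garside

/-! ### Generated groups and the monoids `M_{w,X}` -/

section Generated

variable {W : Type*} [Group W]

/-- The length of `w`: the least length of a word on `X` that represents `w`. -/
def wordLength (X : Set W) (w : W) : ℕ :=
  sInf {k | ∃ l : List W, (∀ a ∈ l, a ∈ X) ∧ l.prod = w ∧ l.length = k}

/-- The set of left `X`-factors of `w`. -/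
def leftFactors (X : Set W) (w : W) : Set W :=
  {u | ∃ v, w = u * v ∧ wordLength X w = wordLength X u + wordLength X v}

/-- The set of right `X`-factors of `w`. -/
def rightFactors (X : Set W) (w : W) : Set W :=
  {v | ∃ u, w = u * v ∧ wordLength X w = wordLength X u + wordLength X v}

/-- `w` is `X`-balanced. -/
def IsBalanced (X : Set W) (w : W) : Prop := leftFactors X w = rightFactors X w

/-- The defining relations of `M_{w,X}`, on a copy of the set of factors of `w`. The generator
attached to the neutral element of `W` is the neutral element of the monoid. -/
inductive FactorRel (X : Set W) (w : W) :
    FreeMonoid (leftFactors X w) → FreeMonoid (leftFactors X w) → Prop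
  | one (v : leftFactors X w) (h : (v : W) = 1) : FactorRel X w (FreeMonoid.of v) 1
  | mul (v v' v'' : leftFactors X w) (h : (v : W) * v' = v'')
      (hl : wordLength X (v : W) + wordLength X (v' : W) = wordLength X (v'' : W)) :
      FactorRel X w (FreeMonoid.of v * FreeMonoid.of v') (FreeMonoid.of v'')

/-- The monoid `M_{w,X}` (used for `X`-balanced `w`). -/
abbrev FactorMonoid (X : Set W) (w : W) : Type _ := PresentedMonoid (FactorRel X w)

/-- `(W, X)` is a generating generated group for the monoid `M`, by means of the element `w`. -/
structure IsGeneratingGeneratedGroupVia (X : Set W) (w : W) (M : Type*) [Monoid M] : Prop where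
  generated : Submonoid.closure X = ⊤
  finite : Finite W
  balanced : IsBalanced X w
  factors_generate : Subgroup.closure (leftFactors X w) = ⊤
  iso : Nonempty (FactorMonoid X w ≃* M)

/-- `(W, X)` is a generating generated group for the monoid `M`. -/
def IsGeneratingGeneratedGroup (X : Set W) (M : Type*) [Monoid M] : Prop :=
  ∃ w : W, IsGeneratingGeneratedGroupVia X w M

end Generated

/-! ### Set-theoretic solutions of the Yang-Baxter equation -/

section Solution

variable {X : Type*}

/-- `g_x (y)`, the first component of `S (x, y)`. -/
def gMap (S : X × X → X × X) (x y : X) : X := (S (x, y)).1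

/-- `f_x (y)`, the second component of `S (y, x)`; so `S (x, y) = (g_x (y), f_y (x))`. -/
def fMap (S : X × X → X × X) (x y : X) : X := (S (y, x)).2

/-- `S` acting on the first two components. -/
def act12 (S : X × X → X × X) (p : X × X × X) : X × X × X :=
  ((S (p.1, p.2.1)).1, (S (p.1, p.2.1)).2, p.2.2)

/-- `S` acting on the last two components. -/
def act23 (S : X × X → X × X) (p : X × X × X) : X × X × X := (p.1, S p.2)

/-- `(X, S)` is a non-degenerate symmetric (that is, involutive and braided) set-theoretic
solution of the Yang-Baxter equation. -/
structure IsNondegenerateSymmetric (S : X × X → X × X) : Prop where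
  bijective_g : ∀ x, Function.Bijective (gMap S x)
  bijective_f : ∀ x, Function.Bijective (fMap S x)
  involutive : Function.Involutive S
  braided : act12 S ∘ act23 S ∘ act12 S = act23 S ∘ act12 S ∘ act23 S

/-- The relators of the structure group. -/
def groupRels (S : X × X → X × X) : Set (FreeGroup X) :=
  {r | ∃ x y, S (x, y) ≠ (x, y) ∧
    r = (FreeGroup.of x * FreeGroup.of y) *
      (FreeGroup.of (gMap S x y) * FreeGroup.of (fMap S y x))⁻¹}

/-- The structure group `G(X,S)`. -/
abbrev StructureGroup (S : X × X → X × X) : Type _ := PresentedGroup (groupRels S)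

/-- The defining relations of the structure monoid. -/
inductive MonoidRel (S : X × X → X × X) : FreeMonoid X → FreeMonoid X → Prop
  | rel (x y : X) (h : S (x, y) ≠ (x, y)) :
      MonoidRel S (FreeMonoid.of x * FreeMonoid.of y)
        (FreeMonoid.of (gMap S x y) * FreeMonoid.of (fMap S y x))

/-- The monoid `M(X,S)`, with the same presentation as `G(X,S)`. -/
abbrev StructureMonoid (S : X × X → X × X) : Type _ := PresentedMonoid (MonoidRel S)

/-- The canonical morphism from `M(X,S)` to `G(X,S)`. -/
def monoidToGroup (S : X × X → X × X) : StructureMonoid S →* StructureGroup S :=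
  PresentedMonoid.lift (fun x => (PresentedGroup.of x : StructureGroup S)) <| by
    rintro _ _ ⟨x, y, h⟩
    have := PresentedGroup.one_of_mem (rels := groupRels S) ⟨x, y, h, rfl⟩
    rw [map_mul, map_inv, mul_inv_eq_one, map_mul, map_mul] at this
    exact this

/-! ### The signed permutation representation -/

variable {S : X × X → X × X} (hS : IsNondegenerateSymmetric S)

/-- `f_x` as a permutation of `X`. -/
def fPerm (x : X) : Equiv.Perm X := Equiv.ofBijective (fMap S x) (hS.bijective_f x)

/-- `φ_x`, the inverse of `f_x`. -/
def phi (x : X) : Equiv.Perm X := (fPerm hS x)⁻¹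

variable {V : Type*} [AddCommGroup V] [Module ℝ V] (b : Module.Basis X ℝ V)

open Classical in
/-- `ψ_x` as an element of `GL(V)`: it maps `x` to `-φ_x(x)` and every basis vector `y ≠ x`
to `φ_x(y)` (see the next lemma). -/
def psiGen (x : X) : LinearMap.GeneralLinearGroup ℝ V :=
  LinearMap.GeneralLinearGroup.ofLinearEquiv
    ((b.equiv (b.unitsSMul fun y => if y = x then -1 else 1) (Equiv.refl X)).trans
      (b.equiv b (phi hS x)))

open Classical in
theorem psiGen_apply (x y : X) :
    (psiGen hS b x : V →ₗ[ℝ] V) (b y) = (if y = x then -1 else 1 : ℝ) • b (phi hS x y) := by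
  change (b.equiv b (phi hS x))
    ((b.equiv (b.unitsSMul fun y => if y = x then -1 else 1) (Equiv.refl X)) (b y)) = _
  rw [Module.Basis.equiv_apply, Module.Basis.unitsSMul_apply]
  by_cases h : y = x <;> simp [h]

theorem fMap_fMap {S : X × X → X × X} (hS : IsNondegenerateSymmetric S) (x y z : X) :
    fMap S y (fMap S x z) = fMap S (fMap S y x) (fMap S (gMap S x y) z) := by
  have h := congrArg (fun p => p.2.2) (congrFun hS.braided (z, x, y))
  exact h

theorem fMap_gMap {S : X × X → X × X} (hS : IsNondegenerateSymmetric S) (x y : X) : fMap S (fMap S y x) (gMap S x y) = y :=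
  congrArg Prod.snd (hS.involutive (x, y))

theorem phi_phi (x y z : X) :
    phi hS x (phi hS y z) = phi hS (gMap S x y) (phi hS (fMap S y x) z) := by
  have h : fPerm hS y * fPerm hS x = fPerm hS (fMap S y x) * fPerm hS (gMap S x y) :=
    Equiv.ext fun u => fMap_fMap hS x y u
  have h' := congrArg (fun p => p⁻¹ z) h
  simpa [phi] using h'

theorem phi_eq_iff (x y z : X) : phi hS y z = x ↔ z = fMap S y x :=
  Equiv.Perm.inv_eq_iff_eq (f := fPerm hS y)

theorem psiGen_mul (x y : X) :
    psiGen hS b x * psiGen hS b y =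
      psiGen hS b (gMap S x y) * psiGen hS b (fMap S y x) := by
  classical
  apply Units.ext
  apply b.ext
  intro z
  rw [Units.val_mul, Units.val_mul, Module.End.mul_apply, Module.End.mul_apply]
  simp only [psiGen_apply, map_smul, smul_smul, phi_eq_iff, fMap_gMap hS x y]
  rw [phi_phi hS x y z, mul_comm]

/-- The representation `ψ : G(X,S) → GL(V)`. -/
def psi : StructureGroup S →* LinearMap.GeneralLinearGroup ℝ V :=
  PresentedGroup.toGroup (f := psiGen hS b) <| by
    rintro _ ⟨x, y, -, rfl⟩
    rw [map_mul, map_inv, mul_inv_eq_one, map_mul, map_mul]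
    simpa only [FreeGroup.lift_apply_of] using psiGen_mul hS b x y

/-- The group `W(X,S)`, the image of `ψ`. -/
abbrev WGroup : Subgroup (LinearMap.GeneralLinearGroup ℝ V) := (psi hS b).range

/-- `ψ` as a morphism from `G(X,S)` to `W(X,S)`. -/
def toW : StructureGroup S →* WGroup hS b := (psi hS b).rangeRestrict

/-- The generating set `{ψ_x ∣ x ∈ X}` of `W(X,S)`. -/
def psiSet : Set (WGroup hS b) := Set.range fun x : X => toW hS b (PresentedGroup.of x)

end Solution

end YangBaxter

end

/-!
Recording how often each point of `X` is created when a word is read from left to right, `x` being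
added to a multiset already moved by `f_x`, identifies `M(X,S)` with the multisets on `X` (its
*I-structure*). Together with the permutation attached to an element, this embeds `M(X,S)` in a
semidirect product, whence cancellativity, and right divisibility becomes inclusion of multisets.
The Garside element `Δ` is therefore the one whose multiset is `X` itself, and its divisors are the
elements with a multiplicity-free multiset.

The matrix of `ψ(m)` is monomial with entries `(-1)^k`, where `k` is the multiplicity of the column
in the multiset of `m`. So `ψ(m)` sees the multiset modulo `2`, and an element with a
multiplicity-free multiset is the only shortest lift of its image. For a morphism with this property
at a Garside element `Δ`, factorizations of the image of `Δ` with additive lengths are exactly the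
images of factorizations of `Δ`. Since the relations of `M(X,S)` hold between divisors of `Δ`, they
are among those of the monoid of factors of `ψ(Δ)`.
-/

noncomputable section

namespace YangBaxter

open Function

section Divisibility

variable {M : Type*} [Monoid M]

theorem LeftDivides.trans {f g h : M} (hfg : LeftDivides f g) (hgh : LeftDivides g h) :
    LeftDivides f h := by
  obtain ⟨u, rfl⟩ := hfg
  obtain ⟨v, rfl⟩ := hgh
  exact ⟨u * v, mul_assoc f u v⟩

theorem setOf_leftDivides_eq_setOf_rightDivides [IsLeftCancelMul M] {Δ : M}
    (hfinite : {f | RightDivides f Δ}.Finite)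
    (hsubset : {f | LeftDivides f Δ} ⊆ {f | RightDivides f Δ}) :
    {f | LeftDivides f Δ} = {f | RightDivides f Δ} := by
  choose complement hcomplement using fun n : {f | RightDivides f Δ} => n.2
  have hleft (n) : LeftDivides (complement n) Δ := ⟨n, hcomplement n⟩
  -- An injective self-map of a finite set is onto, so each right divisor is a complement.
  have := hfinite.to_subtype
  have hinj : Injective fun n => (⟨complement n, hsubset (hleft n)⟩ : {f | RightDivides f Δ}) := by
    intro n n' h
    have h' : complement n = complement n' := congrArg Subtype.val h
    exact Subtype.ext (mul_left_cancel ((hcomplement n).symm.trans (h' ▸ hcomplement n')))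
  refine hsubset.antisymm fun s hs => ?_
  obtain ⟨n, hn⟩ := Finite.surjective_of_injective hinj ⟨s, hs⟩
  obtain rfl : complement n = s := congrArg Subtype.val hn
  exact hleft n

end Divisibility

theorem surjective_of_finite_range_of_closure_range_eq_top {M W : Type*} [Monoid M] [Group W]
    {π : M →* W} (hfinite : (Set.range π).Finite)
    (hclosure : Subgroup.closure (Set.range π) = ⊤) : Surjective π := by
  have hfinOrder : ∀ w ∈ Set.range π, IsOfFinOrder w := by
    rintro _ ⟨m, rfl⟩
    refine finite_powers.1 (hfinite.subset ?_)
    rintro _ ⟨k, rfl⟩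
    exact ⟨m ^ k, map_pow π m k⟩
  rw [← MonoidHom.mrange_eq_top, ← Submonoid.closure_eq (MonoidHom.mrange π), MonoidHom.coe_mrange,
    ← Subgroup.closure_toSubmonoid_of_isOfFinOrder hfinOrder, hclosure, Subgroup.top_toSubmonoid]

section WordLength

variable {W : Type*} [Group W] {Y : Set W}

theorem wordLength_prod_le {l : List W} (hl : ∀ a ∈ l, a ∈ Y) : wordLength Y l.prod ≤ l.length :=
  Nat.sInf_le ⟨l, hl, rfl, rfl⟩

theorem exists_list_length_eq_wordLength (hY : Submonoid.closure Y = ⊤) (w : W) :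
    ∃ l : List W, (∀ a ∈ l, a ∈ Y) ∧ l.prod = w ∧ l.length = wordLength Y w := by
  obtain ⟨l, hl, hw⟩ := Submonoid.exists_list_of_mem_closure (hY ▸ Submonoid.mem_top w)
  exact Nat.sInf_mem
    (s := {k | ∃ l : List W, (∀ a ∈ l, a ∈ Y) ∧ l.prod = w ∧ l.length = k}) ⟨_, l, hl, hw, rfl⟩

theorem wordLength_mul_le (hY : Submonoid.closure Y = ⊤) (u v : W) :
    wordLength Y (u * v) ≤ wordLength Y u + wordLength Y v := by
  obtain ⟨l, hl, rfl, hlu⟩ := exists_list_length_eq_wordLength hY u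
  obtain ⟨l', hl', rfl, hlv⟩ := exists_list_length_eq_wordLength hY v
  rw [← hlu, ← hlv, ← List.prod_append, ← List.length_append]
  exact wordLength_prod_le fun a ha => (List.mem_append.1 ha).elim (hl a) (hl' a)

end WordLength

/-- The family `ι` generates the monoid, and `ℓ` is an additive length function for which each
`ι a` has length one. Then all words on `ι` representing `m` have the same length `ℓ m`. -/
structure IsAdditiveLength {α M : Type*} [Monoid M] (ι : α → M) (ℓ : M → ℕ) : Prop where
  closure_range : Submonoid.closure (Set.range ι) = ⊤
  map_mul : ∀ m n, ℓ (m * n) = ℓ m + ℓ n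
  map_gen : ∀ a, ℓ (ι a) = 1

namespace IsAdditiveLength

variable {α M : Type*} [Monoid M] {ι : α → M} {ℓ : M → ℕ} (hℓ : IsAdditiveLength ι ℓ)
include hℓ

theorem map_one : ℓ 1 = 0 := by
  simpa using hℓ.map_mul 1 1

theorem map_prod (l : List α) : ℓ (l.map ι).prod = l.length := by
  induction l with
  | nil => exact hℓ.map_one
  | cons a l ih =>
    rw [List.map_cons, List.prod_cons, hℓ.map_mul, hℓ.map_gen, ih, List.length_cons, add_comm]

theorem exists_word (m : M) : ∃ l : List α, (l.map ι).prod = m := by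
  obtain ⟨l, hl, hm⟩ :=
    Submonoid.exists_list_of_mem_closure (hℓ.closure_range ▸ Submonoid.mem_top m)
  obtain ⟨l, rfl⟩ : l ∈ Set.range (List.map ι) := by rwa [Set.range_list_map]
  exact ⟨l, hm⟩

theorem eq_one_of_length_eq_zero {m : M} (hm : ℓ m = 0) : m = 1 := by
  obtain ⟨l, rfl⟩ := hℓ.exists_word m
  rw [hℓ.map_prod, List.length_eq_zero_iff] at hm
  rw [hm, List.map_nil, List.prod_nil]

theorem gen_mem_of_closure_eq_top {s : Set M} (hs : Submonoid.closure s = ⊤) (a : α) :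
    ι a ∈ s := by
  suffices ∀ m ∈ Submonoid.closure s, ℓ m = 1 → m ∈ s from
    this _ (hs ▸ Submonoid.mem_top _) (hℓ.map_gen a)
  intro m hm
  induction hm using Submonoid.closure_induction with
  | mem y hy => exact fun _ => hy
  | one => simp [hℓ.map_one]
  | mul y z _ _ hy hz =>
    rw [hℓ.map_mul, Nat.add_eq_one_iff]
    rintro (⟨h0, h1⟩ | ⟨h1, h0⟩)
    · rw [hℓ.eq_one_of_length_eq_zero h0, one_mul]
      exact hz h1
    · rw [hℓ.eq_one_of_length_eq_zero h0, mul_one]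
      exact hy h1

variable {W : Type*} [Group W] {π : M →* W}

theorem wordLength_le (m : M) : wordLength (Set.range (π ∘ ι)) (π m) ≤ ℓ m := by
  obtain ⟨l, rfl⟩ := hℓ.exists_word m
  rw [hℓ.map_prod, map_list_prod, List.map_map, ← List.length_map (π ∘ ι)]
  refine wordLength_prod_le fun a ha => ?_
  obtain ⟨x, -, rfl⟩ := List.mem_map.1 ha
  exact ⟨x, rfl⟩

theorem closure_range_comp (hπ : Surjective π) :
    Submonoid.closure (Set.range (π ∘ ι)) = ⊤ := by
  rw [Set.range_comp, ← MonoidHom.map_mclosure, hℓ.closure_range,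
    ← MonoidHom.mrange_eq_map, MonoidHom.mrange_eq_top.2 hπ]

theorem exists_lift_length_eq_wordLength (hπ : Surjective π) (w : W) :
    ∃ m, π m = w ∧ ℓ m = wordLength (Set.range (π ∘ ι)) w := by
  obtain ⟨l, hl, hw, hlength⟩ :=
    exists_list_length_eq_wordLength (hℓ.closure_range_comp hπ) w
  obtain ⟨l, rfl⟩ : l ∈ Set.range (List.map (π ∘ ι)) := by rwa [Set.range_list_map]
  refine ⟨(l.map ι).prod, ?_, ?_⟩
  · rw [← hw, map_list_prod, List.map_map]
  · rw [hℓ.map_prod, ← hlength, List.length_map]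

end IsAdditiveLength

/-- Every element other than `m` with the same image under `π` is strictly longer than `m`. Such
an `m` can be recovered from its image, which makes the factors of `π m` liftable. -/
def IsUniqueShortestLift {M W : Type*} [Monoid M] [Group W] (ℓ : M → ℕ) (π : M →* W) (m : M) :
    Prop :=
  ∀ m', π m' = π m → ℓ m' ≤ ℓ m → m' = m

namespace IsUniqueShortestLift

variable {α M W : Type*} [Monoid M] [Group W] {ι : α → M} {ℓ : M → ℕ} {π : M →* W}

theorem eq_of_map_eq {m m' : M} (hm : IsUniqueShortestLift ℓ π m)
    (hm' : IsUniqueShortestLift ℓ π m') (h : π m = π m') : m = m' :=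
  (le_total (ℓ m) (ℓ m')).elim (hm' m h) fun hle => (hm m' h.symm hle).symm

theorem of_mul_left [IsRightCancelMul M] (hℓ : IsAdditiveLength ι ℓ) {s t : M}
    (h : IsUniqueShortestLift ℓ π (s * t)) : IsUniqueShortestLift ℓ π s := fun s' hs hle =>
  mul_right_cancel <| h (s' * t) (by rw [map_mul, map_mul, hs]) <| by
    rw [hℓ.map_mul, hℓ.map_mul]
    gcongr

theorem of_leftDivides [IsRightCancelMul M] (hℓ : IsAdditiveLength ι ℓ) {s m : M}
    (hm : IsUniqueShortestLift ℓ π m) (hs : LeftDivides s m) : IsUniqueShortestLift ℓ π s := by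
  obtain ⟨t, rfl⟩ := hs
  exact hm.of_mul_left hℓ

theorem wordLength_eq (hℓ : IsAdditiveLength ι ℓ) (hπ : Surjective π) {m : M}
    (hm : IsUniqueShortestLift ℓ π m) : wordLength (Set.range (π ∘ ι)) (π m) = ℓ m := by
  obtain ⟨m', hπm', hm'⟩ := hℓ.exists_lift_length_eq_wordLength hπ (π m)
  rw [← hm', hm m' hπm' (hm' ▸ hℓ.wordLength_le m)]

theorem exists_lift_of_eq_mul (hℓ : IsAdditiveLength ι ℓ) (hπ : Surjective π) {m : M}
    (hm : IsUniqueShortestLift ℓ π m) {u v : W} (h : π m = u * v)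
    (hlength : wordLength (Set.range (π ∘ ι)) (π m) =
      wordLength (Set.range (π ∘ ι)) u + wordLength (Set.range (π ∘ ι)) v) :
    ∃ s t, π s = u ∧ π t = v ∧ m = s * t := by
  obtain ⟨s, rfl, hs⟩ := hℓ.exists_lift_length_eq_wordLength hπ u
  obtain ⟨t, rfl, ht⟩ := hℓ.exists_lift_length_eq_wordLength hπ v
  refine ⟨s, t, rfl, rfl, (hm (s * t) (by rw [h, map_mul]) ?_).symm⟩
  rw [hℓ.map_mul, hs, ht, ← hlength, hm.wordLength_eq hℓ hπ]

section Factors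

variable (hℓ : IsAdditiveLength ι ℓ) (hπ : Surjective π)
include hℓ hπ

theorem wordLength_mul {s t : M} (h : IsUniqueShortestLift ℓ π (s * t)) :
    wordLength (Set.range (π ∘ ι)) (π (s * t)) =
      wordLength (Set.range (π ∘ ι)) (π s) + wordLength (Set.range (π ∘ ι)) (π t) := by
  refine le_antisymm ?_ ?_
  · rw [map_mul]
    exact wordLength_mul_le (hℓ.closure_range_comp hπ) _ _
  · rw [h.wordLength_eq hℓ hπ, hℓ.map_mul]
    exact Nat.add_le_add (hℓ.wordLength_le s) (hℓ.wordLength_le t)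

variable {Δ : M} (hΔ : IsUniqueShortestLift ℓ π Δ)
include hΔ

theorem leftFactors_eq :
    leftFactors (Set.range (π ∘ ι)) (π Δ) = π '' {s | LeftDivides s Δ} := by
  ext u
  constructor
  · rintro ⟨v, h, hlength⟩
    obtain ⟨s, t, rfl, -, rfl⟩ := hΔ.exists_lift_of_eq_mul hℓ hπ h hlength
    exact ⟨s, ⟨t, rfl⟩, rfl⟩
  · rintro ⟨s, ⟨t, rfl⟩, rfl⟩
    exact ⟨π t, map_mul π s t, hΔ.wordLength_mul hℓ hπ⟩

theorem rightFactors_eq :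
    rightFactors (Set.range (π ∘ ι)) (π Δ) = π '' {s | RightDivides s Δ} := by
  ext v
  constructor
  · rintro ⟨u, h, hlength⟩
    obtain ⟨s, t, -, rfl, rfl⟩ := hΔ.exists_lift_of_eq_mul hℓ hπ h hlength
    exact ⟨t, ⟨s, rfl⟩, rfl⟩
  · rintro ⟨t, ⟨s, rfl⟩, rfl⟩
    exact ⟨π s, map_mul π s t, hΔ.wordLength_mul hℓ hπ⟩

variable [IsRightCancelMul M]

/-- The left divisors of `Δ` correspond to the left factors of its image. -/
def divisorEquiv : {s // LeftDivides s Δ} ≃ leftFactors (Set.range (π ∘ ι)) (π Δ) :=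
  Equiv.ofBijective
    (fun s => ⟨π s, hΔ.leftFactors_eq hℓ hπ ▸ Set.mem_image_of_mem π s.2⟩) <| by
    refine ⟨fun s t h => Subtype.ext ?_, ?_⟩
    · exact (hΔ.of_leftDivides hℓ s.2).eq_of_map_eq (hΔ.of_leftDivides hℓ t.2)
        (congrArg Subtype.val h)
    · rintro ⟨u, hu⟩
      obtain ⟨s, hs, rfl⟩ := hΔ.leftFactors_eq hℓ hπ ▸ hu
      exact ⟨⟨s, hs⟩, rfl⟩

theorem map_divisorEquiv_symm (u : leftFactors (Set.range (π ∘ ι)) (π Δ)) :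
    π ((hΔ.divisorEquiv hℓ hπ).symm u) = u :=
  congrArg Subtype.val ((hΔ.divisorEquiv hℓ hπ).apply_symm_apply u)

theorem wordLength_factor (u : leftFactors (Set.range (π ∘ ι)) (π Δ)) :
    wordLength (Set.range (π ∘ ι)) u = ℓ ((hΔ.divisorEquiv hℓ hπ).symm u) := by
  rw [← (hΔ.of_leftDivides hℓ ((hΔ.divisorEquiv hℓ hπ).symm u).2).wordLength_eq hℓ hπ,
    hΔ.map_divisorEquiv_symm hℓ hπ]

/-- The morphism from the factor monoid of `π Δ` that replaces each factor by the divisor of `Δ`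
lying over it. -/
def ofFactorMonoid : FactorMonoid (Set.range (π ∘ ι)) (π Δ) →* M :=
  PresentedMonoid.lift (fun u => ((hΔ.divisorEquiv hℓ hπ).symm u : M)) <| by
    have hshort (u) : IsUniqueShortestLift ℓ π ((hΔ.divisorEquiv hℓ hπ).symm u) :=
      hΔ.of_leftDivides hℓ ((hΔ.divisorEquiv hℓ hπ).symm u).2
    rintro _ _ (⟨v, hv⟩ | ⟨v, v', v'', hv, hlength⟩)
    · rw [FreeMonoid.lift_eval_of, _root_.map_one]
      refine (hshort v 1 ?_ ?_).symm
      · rw [_root_.map_one, hΔ.map_divisorEquiv_symm hℓ hπ, hv]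
      · rw [hℓ.map_one]
        exact Nat.zero_le _
    · simp only [map_mul, FreeMonoid.lift_eval_of]
      refine hshort v'' _ ?_ ?_
      · simp only [map_mul, hΔ.map_divisorEquiv_symm hℓ hπ, hv]
      · simp only [hℓ.map_mul, ← hΔ.wordLength_factor hℓ hπ, hlength, le_refl]

theorem of_divisorEquiv_mul {s t : M}
    (hs : LeftDivides s Δ) (ht : LeftDivides t Δ) (hst : LeftDivides (s * t) Δ) :
    PresentedMonoid.of (FactorRel (Set.range (π ∘ ι)) (π Δ)) (hΔ.divisorEquiv hℓ hπ ⟨s, hs⟩) *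
        PresentedMonoid.of _ (hΔ.divisorEquiv hℓ hπ ⟨t, ht⟩) =
      PresentedMonoid.of _ (hΔ.divisorEquiv hℓ hπ ⟨s * t, hst⟩) :=
  PresentedMonoid.mk_eq_mk_of_rel <| FactorRel.mul _ _ _ (map_mul π s t).symm
    ((hΔ.of_leftDivides hℓ hst).wordLength_mul hℓ hπ).symm

end Factors

section Presented

variable {rel : FreeMonoid α → FreeMonoid α → Prop} {ℓ : PresentedMonoid rel → ℕ}
  {π : PresentedMonoid rel →* W} [IsRightCancelMul (PresentedMonoid rel)]
  (hℓ : IsAdditiveLength (PresentedMonoid.of rel) ℓ) (hπ : Surjective π)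
  {Δ : PresentedMonoid rel} (hΔ : IsUniqueShortestLift ℓ π Δ)
  (hgen : ∀ a, LeftDivides (PresentedMonoid.of rel a) Δ)

theorem lift_divisorEquiv_of (word : FreeMonoid α)
    (hword : LeftDivides (PresentedMonoid.mk rel word) Δ) :
    FreeMonoid.lift (fun a => PresentedMonoid.of
        (FactorRel (Set.range (π ∘ PresentedMonoid.of rel)) (π Δ))
        (hΔ.divisorEquiv hℓ hπ ⟨_, hgen a⟩)) word =
      PresentedMonoid.of _ (hΔ.divisorEquiv hℓ hπ ⟨_, hword⟩) := by
  induction word using Submonoid.induction_of_closure_eq_top_right FreeMonoid.closure_range_of with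
  | one =>
    rw [map_one]
    exact (PresentedMonoid.mk_eq_mk_of_rel (FactorRel.one _ (map_one π))).symm
  | mul_right word _ ha ih =>
    obtain ⟨a, rfl⟩ := ha
    have hprefix : LeftDivides (PresentedMonoid.mk rel word) Δ :=
      LeftDivides.trans ⟨PresentedMonoid.of rel a, map_mul _ _ _⟩ hword
    rw [map_mul, ih hprefix, FreeMonoid.lift_eval_of]
    exact hΔ.of_divisorEquiv_mul hℓ hπ hprefix (hgen a) hword

/-- The morphism to the factor monoid of `π Δ` that maps each generator to its image under `π`. -/
def toFactorMonoid (hrel : ∀ v w, rel v w → LeftDivides (PresentedMonoid.mk rel v) Δ) :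
    PresentedMonoid rel →* FactorMonoid (Set.range (π ∘ PresentedMonoid.of rel)) (π Δ) :=
  PresentedMonoid.lift
    (fun a => PresentedMonoid.of _ (hΔ.divisorEquiv hℓ hπ ⟨_, hgen a⟩)) <| by
    intro v w hvw
    have heq : PresentedMonoid.mk rel v = PresentedMonoid.mk rel w :=
      PresentedMonoid.mk_eq_mk_of_rel hvw
    have hv := hrel v w hvw
    rw [hΔ.lift_divisorEquiv_of hℓ hπ hgen v hv, hΔ.lift_divisorEquiv_of hℓ hπ hgen w (heq ▸ hv)]
    simp only [heq]

/-- The factor monoid of `π Δ` is the monoid itself, provided that the defining relations hold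
between divisors of `Δ`. -/
def factorMonoidEquiv (hrel : ∀ v w, rel v w → LeftDivides (PresentedMonoid.mk rel v) Δ) :
    FactorMonoid (Set.range (π ∘ PresentedMonoid.of rel)) (π Δ) ≃* PresentedMonoid rel :=
  MonoidHom.toMulEquiv (hΔ.ofFactorMonoid hℓ hπ) (hΔ.toFactorMonoid hℓ hπ hgen hrel)
    (PresentedMonoid.ext _ fun u => by
      obtain ⟨⟨s, hs⟩, rfl⟩ := (hΔ.divisorEquiv hℓ hπ).surjective u
      obtain ⟨word, rfl⟩ := PresentedMonoid.surjective_mk s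
      change hΔ.toFactorMonoid hℓ hπ hgen hrel ((hΔ.divisorEquiv hℓ hπ).symm _ : _) = _
      rw [Equiv.symm_apply_apply]
      exact hΔ.lift_divisorEquiv_of hℓ hπ hgen word hs)
    (PresentedMonoid.ext _ fun a =>
      congrArg Subtype.val ((hΔ.divisorEquiv hℓ hπ).symm_apply_apply ⟨_, hgen a⟩))

include hℓ hπ hΔ in
theorem isGeneratingGeneratedGroupVia [Finite W] (hGarside : IsGarsideElement Δ)
    (hrel : ∀ v w, rel v w → LeftDivides (PresentedMonoid.mk rel v) Δ) :
    IsGeneratingGeneratedGroupVia (Set.range (π ∘ PresentedMonoid.of rel)) (π Δ)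
      (PresentedMonoid rel) where
  generated := hℓ.closure_range_comp hπ
  finite := inferInstance
  balanced := by
    rw [IsBalanced, hΔ.leftFactors_eq hℓ hπ, hΔ.rightFactors_eq hℓ hπ, hGarside.balanced]
  factors_generate := by
    rw [hΔ.leftFactors_eq hℓ hπ, ← Subgroup.toSubmonoid_inj, Subgroup.closure_toSubmonoid_of_finite,
      ← MonoidHom.map_mclosure, hGarside.generates, ← MonoidHom.mrange_eq_map,
      MonoidHom.mrange_eq_top.2 hπ, Subgroup.top_toSubmonoid]
  iso := ⟨hΔ.factorMonoidEquiv hℓ hπ (hℓ.gen_mem_of_closure_eq_top hGarside.generates) hrel⟩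

end Presented

end IsUniqueShortestLift

namespace StructureMonoid

variable {X : Type*} {S : X × X → X × X}

/-- The generator of the structure monoid attached to a point of `X`. -/
abbrev gen (S : X × X → X × X) (x : X) : StructureMonoid S := PresentedMonoid.of (MonoidRel S) x

@[elab_as_elim]
theorem induction_right {p : StructureMonoid S → Prop} (m : StructureMonoid S) (one : p 1)
    (mul_gen : ∀ a x, p a → p (a * gen S x)) : p m := by
  induction m using
    Submonoid.induction_of_closure_eq_top_right (PresentedMonoid.closure_range_of _) with
  | one => exact one
  | mul_right a _ hx ha =>
    obtain ⟨x, rfl⟩ := hx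
    exact mul_gen a x ha

theorem gen_mul_gen (x y : X) : gen S x * gen S y = gen S (gMap S x y) * gen S (fMap S y x) := by
  by_cases h : S (x, y) = (x, y)
  · simp only [gMap, fMap, h]
  · exact PresentedMonoid.mk_eq_mk_of_rel (MonoidRel.rel x y h)

variable (hS : IsNondegenerateSymmetric S)

theorem fMap_phi (x y : X) : fMap S x (phi hS x y) = y :=
  ((phi_eq_iff hS _ _ _).1 rfl).symm

theorem gMap_eq_phi (x y : X) : gMap S x y = phi hS (fMap S y x) y :=
  ((phi_eq_iff hS _ _ _).2 (fMap_gMap hS x y).symm).symm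

theorem gen_phi_mul_gen (x y : X) :
    gen S (phi hS x y) * gen S x = gen S (phi hS y x) * gen S y := by
  rw [gen_mul_gen, gMap_eq_phi hS, fMap_phi]

/-- The permutation attached to an element of the structure monoid: a generator `x` acts
by `φ_x`. -/
def perm : StructureMonoid S →* Equiv.Perm X :=
  PresentedMonoid.lift (phi hS) <| by
    rintro _ _ ⟨x, y, -⟩
    simp only [map_mul, FreeMonoid.lift_eval_of]
    exact Equiv.ext fun z => phi_phi hS x y z

theorem perm_gen (x : X) : perm hS (gen S x) = phi hS x := rfl

theorem coe_perm_gen_inv (x : X) : ⇑(perm hS (gen S x))⁻¹ = fMap S x := rfl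

/-- The right action of the structure monoid on multisets in which a generator `x` moves the
multiset by `f_x` and then adds the point `x`. -/
def multisetAction : StructureMonoid S →* (Function.End (Multiset X))ᵐᵒᵖ :=
  PresentedMonoid.lift (M := (Function.End (Multiset X))ᵐᵒᵖ)
      (fun x => MulOpposite.op fun v => x ::ₘ v.map (fMap S x)) <| by
    rintro _ _ ⟨x, y, -⟩
    simp only [map_mul, FreeMonoid.lift_eval_of]
    refine MulOpposite.unop_injective (funext fun v => ?_)
    change y ::ₘ (x ::ₘ v.map (fMap S x)).map (fMap S y) =
      fMap S y x ::ₘ (gMap S x y ::ₘ v.map (fMap S (gMap S x y))).map (fMap S (fMap S y x))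
    simp only [Multiset.map_cons, Multiset.map_map, comp_def, fMap_fMap hS x y, fMap_gMap hS x y]
    exact Multiset.cons_swap _ _ _

/-- The multiset of points of `X` attached to an element of the structure monoid: the inverse of
the I-structure of the solution. -/
def exponents (m : StructureMonoid S) : Multiset X := (multisetAction hS m).unop 0

theorem exponents_one : exponents hS (1 : StructureMonoid S) = 0 := by
  rw [exponents, map_one]
  rfl

theorem exponents_mul_gen (m : StructureMonoid S) (x : X) :
    exponents hS (m * gen S x) = x ::ₘ (exponents hS m).map (fMap S x) := by
  rw [exponents, map_mul]
  rfl

theorem exponents_gen (x : X) : exponents hS (gen S x) = {x} := by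
  rw [← one_mul (gen S x), exponents_mul_gen, exponents_one]
  rfl

theorem exponents_mul (m n : StructureMonoid S) :
    exponents hS (m * n) = (exponents hS m).map ⇑(perm hS n)⁻¹ + exponents hS n := by
  induction n using induction_right with
  | one => simp [exponents_one]
  | mul_gen a x ih =>
    rw [← mul_assoc, exponents_mul_gen, exponents_mul_gen, ih, map_mul, mul_inv_rev,
      Equiv.Perm.coe_mul, coe_perm_gen_inv, ← Multiset.map_map, Multiset.map_add,
      Multiset.add_cons]

theorem exists_mul_gen_of_mem_exponents {m : StructureMonoid S} {x : X}
    (hx : x ∈ exponents hS m) : ∃ a, m = a * gen S x := by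
  induction m using induction_right generalizing x with
  | one => simp [exponents_one] at hx
  | mul_gen a y ih =>
    rw [exponents_mul_gen, Multiset.mem_cons, Multiset.mem_map] at hx
    obtain rfl | ⟨z, hz, rfl⟩ := hx
    · exact ⟨a, rfl⟩
    · obtain ⟨c, rfl⟩ := ih hz
      have hphi : phi hS y (fMap S y z) = z := (phi_eq_iff hS _ _ _).2 rfl
      refine ⟨c * gen S (phi hS (fMap S y z) y), ?_⟩
      rw [mul_assoc, mul_assoc, ← gen_phi_mul_gen, hphi]

theorem exponents_injective : Injective (exponents hS) := by
  intro m n h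
  induction m using induction_right generalizing n with
  | one =>
    induction n using induction_right with
    | one => rfl
    | mul_gen b y => simp [exponents_one, exponents_mul_gen] at h
  | mul_gen a x ih =>
    obtain ⟨b, rfl⟩ : ∃ b, n = b * gen S x :=
      exists_mul_gen_of_mem_exponents hS (h ▸ exponents_mul_gen hS a x ▸ Multiset.mem_cons_self x _)
    rw [exponents_mul_gen, exponents_mul_gen, Multiset.cons_inj_right] at h
    rw [ih (Multiset.map_injective (hS.bijective_f x).injective h)]

theorem exponents_surjective : Surjective (exponents hS) := by
  suffices ∀ (v : Multiset X) (σ : Equiv.Perm X), ∃ m, exponents hS m = v.map σ from fun v => by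
    simpa using this v 1
  intro v
  induction v using Multiset.induction_on with
  | empty => exact fun _ => ⟨1, exponents_one hS⟩
  | cons x v ih =>
    intro σ
    obtain ⟨m, hm⟩ := ih (phi hS (σ x) * σ)
    refine ⟨m * gen S (σ x), ?_⟩
    rw [exponents_mul_gen, hm, Multiset.map_map, Multiset.map_cons]
    simp only [comp_def, Equiv.Perm.mul_apply, fMap_phi]

include hS in
theorem isCancelMul : IsCancelMul (StructureMonoid S) where
  mul_left_cancel m n n' h := by
    have hperm : perm hS n = perm hS n' := by
      have := congrArg (perm hS) h
      simpa only [map_mul, mul_right_inj] using this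
    have hexp := congrArg (exponents hS) h
    simp only [exponents_mul, hperm, add_right_inj] at hexp
    exact exponents_injective hS hexp
  mul_right_cancel n m m' h := by
    have hexp := congrArg (exponents hS) h
    simp only [exponents_mul, add_left_inj] at hexp
    exact exponents_injective hS (Multiset.map_injective (perm hS n)⁻¹.injective hexp)

theorem isAdditiveLength_card_exponents :
    IsAdditiveLength (gen S) fun m => (exponents hS m).card where
  closure_range := PresentedMonoid.closure_range_of _
  map_mul m n := by rw [exponents_mul, Multiset.card_add, Multiset.card_map]
  map_gen x := by rw [exponents_gen, Multiset.card_singleton]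

theorem rightDivides_iff_exponents_le {n m : StructureMonoid S} :
    RightDivides n m ↔ exponents hS n ≤ exponents hS m := by
  constructor
  · rintro ⟨u, rfl⟩
    rw [exponents_mul]
    exact Multiset.le_add_left _ _
  · intro h
    obtain ⟨v, hv⟩ := Multiset.le_iff_exists_add.1 h
    obtain ⟨u, hu⟩ := exponents_surjective hS (v.map (perm hS n))
    refine ⟨u, exponents_injective hS ?_⟩
    rw [exponents_mul, hu, hv, Multiset.map_map, add_comm]
    simp

theorem nodup_exponents_of_leftDivides {s m : StructureMonoid S} (h : LeftDivides s m)
    (hm : (exponents hS m).Nodup) : (exponents hS s).Nodup := by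
  obtain ⟨t, rfl⟩ := h
  rw [exponents_mul] at hm
  exact (Multiset.nodup_of_le (Multiset.le_add_right _ _) hm).of_map

include hS in
theorem finite_setOf_rightDivides (m : StructureMonoid S) : {s | RightDivides s m}.Finite := by
  classical
  refine ((Set.finite_Iic (exponents hS m)).preimage (exponents_injective hS).injOn).subset ?_
  exact fun s hs => (rightDivides_iff_exponents_le hS).1 hs

theorem nodup_exponents_gen_mul_gen {x y : X} (h : S (x, y) ≠ (x, y)) :
    (exponents hS (gen S x * gen S y)).Nodup := by
  rw [exponents_mul_gen, exponents_gen, Multiset.map_singleton, Multiset.nodup_cons,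
    Multiset.mem_singleton]
  refine ⟨fun hy => h (Prod.ext ?_ hy.symm), Multiset.nodup_singleton _⟩
  apply (hS.bijective_f y).injective
  calc fMap S y (gMap S x y) = fMap S (fMap S y x) (gMap S x y) := by rw [← hy]
    _ = y := fMap_gMap hS x y
    _ = fMap S y x := hy

section Garside

variable [Fintype X] {Δ : StructureMonoid S}

theorem rightDivides_iff_nodup_exponents (hΔ : exponents hS Δ = Finset.univ.val)
    {s : StructureMonoid S} : RightDivides s Δ ↔ (exponents hS s).Nodup := by
  rw [rightDivides_iff_exponents_le hS, hΔ]
  exact ⟨fun h => Multiset.nodup_of_le h Finset.univ.nodup,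
    fun h => (Multiset.le_iff_subset h).2 fun x _ => Finset.mem_univ x⟩

theorem setOf_leftDivides_eq_setOf_rightDivides (hΔ : exponents hS Δ = Finset.univ.val) :
    {s | LeftDivides s Δ} = {s | RightDivides s Δ} := by
  have := isCancelMul hS
  refine YangBaxter.setOf_leftDivides_eq_setOf_rightDivides (finite_setOf_rightDivides hS Δ) ?_
  intro s hs
  exact (rightDivides_iff_nodup_exponents hS hΔ).2
    (nodup_exponents_of_leftDivides hS hs (hΔ ▸ Finset.univ.nodup))

theorem leftDivides_iff_nodup_exponents (hΔ : exponents hS Δ = Finset.univ.val)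
    {s : StructureMonoid S} : LeftDivides s Δ ↔ (exponents hS s).Nodup :=
  (Set.ext_iff.1 (setOf_leftDivides_eq_setOf_rightDivides hS hΔ) s).trans
    (rightDivides_iff_nodup_exponents hS hΔ)

theorem isGarsideElement_of_exponents_eq (hΔ : exponents hS Δ = Finset.univ.val) :
    IsGarsideElement Δ where
  balanced := setOf_leftDivides_eq_setOf_rightDivides hS hΔ
  generates := by
    rw [← top_le_iff, ← PresentedMonoid.closure_range_of]
    refine Submonoid.closure_mono ?_
    rintro _ ⟨x, rfl⟩
    refine (leftDivides_iff_nodup_exponents hS hΔ).2 ?_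
    rw [exponents_gen]
    exact Multiset.nodup_singleton x

theorem univ_le_exponents_of_isGarsideElement (hΔ : IsGarsideElement Δ) :
    Finset.univ.val ≤ exponents hS Δ := by
  refine (Multiset.le_iff_subset Finset.univ.nodup).2 fun x _ => ?_
  have hx : gen S x ∈ {s | RightDivides s Δ} := hΔ.balanced ▸
    (isAdditiveLength_card_exponents hS).gen_mem_of_closure_eq_top hΔ.generates x
  rw [← Multiset.singleton_le, ← exponents_gen hS]
  exact (rightDivides_iff_exponents_le hS).1 hx

theorem isTheGarsideElement_iff :
    IsTheGarsideElement Δ ↔ exponents hS Δ = Finset.univ.val := by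
  constructor
  · intro h
    obtain ⟨Δ', hΔ'⟩ := exponents_surjective hS Finset.univ.val
    have hdvd := h.least_right Δ' (isGarsideElement_of_exponents_eq hS hΔ')
    exact le_antisymm (hΔ' ▸ (rightDivides_iff_exponents_le hS).1 hdvd)
      (univ_le_exponents_of_isGarsideElement hS h.isGarside)
  · intro hΔ
    have hright (Δ') (h : IsGarsideElement Δ') : RightDivides Δ Δ' :=
      (rightDivides_iff_exponents_le hS).2 (hΔ ▸ univ_le_exponents_of_isGarsideElement hS h)
    exact ⟨isGarsideElement_of_exponents_eq hS hΔ,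
      fun Δ' h => h.balanced.symm.subset (hright Δ' h), hright⟩

theorem leftDivides_mk_of_monoidRel (hΔ : exponents hS Δ = Finset.univ.val)
    (v w : FreeMonoid X) (h : MonoidRel S v w) :
    LeftDivides (PresentedMonoid.mk (MonoidRel S) v) Δ := by
  obtain ⟨x, y, hxy⟩ := h
  exact (leftDivides_iff_nodup_exponents hS hΔ).2 (nodup_exponents_gen_mul_gen hS hxy)

end Garside

include hS in
theorem existsUnique_isTheGarsideElement [Finite X] :
    ∃! Δ : StructureMonoid S, IsTheGarsideElement Δ := by
  have := Fintype.ofFinite X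
  simp only [isTheGarsideElement_iff hS]
  exact Bijective.existsUnique ⟨exponents_injective hS, exponents_surjective hS⟩ _

section Representation

variable {V : Type*} [AddCommGroup V] [Module ℝ V] (b : Module.Basis X ℝ V)

/-- The morphism from the structure monoid to `W(X,S)` induced by `ψ`. -/
def proj : StructureMonoid S →* WGroup hS b := (toW hS b).comp (monoidToGroup S)

theorem coe_proj_gen (x : X) :
    (proj hS b (gen S x) : LinearMap.GeneralLinearGroup ℝ V) = psiGen hS b x :=
  PresentedGroup.toGroup.of _

open Classical in
theorem proj_apply_basis (m : StructureMonoid S) (z : X) :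
    ((proj hS b m : LinearMap.GeneralLinearGroup ℝ V) : V →ₗ[ℝ] V) (b z) =
      (-1 : ℝ) ^ (exponents hS m).count z • b (perm hS m z) := by
  induction m using induction_right generalizing z with
  | one => simp [exponents_one]
  | mul_gen a x ih =>
    have hcount : ((exponents hS a).map (fMap S x)).count z =
        (exponents hS a).count (phi hS x z) := by
      nth_rw 1 [← fMap_phi hS x z]
      exact Multiset.count_map_eq_count' _ _ (hS.bijective_f x).injective _
    rw [map_mul, Subgroup.coe_mul, Units.val_mul, Module.End.mul_apply, coe_proj_gen,
      psiGen_apply, map_smul, ih, smul_smul, map_mul, perm_gen, exponents_mul_gen,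
      Multiset.count_cons, hcount, pow_add, mul_comm, Equiv.Perm.mul_apply]
    by_cases h : z = x <;> simp [h]

open Classical in
theorem even_count_exponents_iff_of_proj_eq {m n : StructureMonoid S}
    (h : proj hS b m = proj hS b n) (z : X) :
    Even ((exponents hS m).count z) ↔ Even ((exponents hS n).count z) := by
  have hsign (m) : b.constr ℝ (fun _ => (1 : ℝ))
      (((proj hS b m : LinearMap.GeneralLinearGroup ℝ V) : V →ₗ[ℝ] V) (b z)) =
        (-1) ^ (exponents hS m).count z := by
    rw [proj_apply_basis, map_smul, Module.Basis.constr_basis, smul_eq_mul, mul_one]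
  have hne : (-1 : ℝ) ≠ 1 := by norm_num
  rw [← neg_one_pow_eq_one_iff_even hne, ← neg_one_pow_eq_one_iff_even hne, ← hsign, ← hsign, h]

theorem isUniqueShortestLift_of_nodup_exponents {m : StructureMonoid S}
    (hm : (exponents hS m).Nodup) :
    IsUniqueShortestLift (fun m => (exponents hS m).card) (proj hS b) m := by
  classical
  intro n h hcard
  have hle : exponents hS m ≤ exponents hS n := by
    refine (Multiset.le_iff_subset hm).2 fun z hz => ?_
    by_contra hzn
    have heven := even_count_exponents_iff_of_proj_eq hS b h z
    simp [Multiset.count_eq_zero_of_notMem hzn, Multiset.count_eq_one_of_mem hm hz] at heven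
  exact exponents_injective hS (Multiset.eq_of_le_of_card_le hle hcard).symm

open Classical in
theorem proj_eq_of_perm_eq_of_even_count_iff {m n : StructureMonoid S}
    (hperm : perm hS m = perm hS n)
    (heven : ∀ z, Even ((exponents hS m).count z) ↔ Even ((exponents hS n).count z)) :
    proj hS b m = proj hS b n := by
  refine Subtype.ext (Units.ext (b.ext fun z => ?_))
  rw [proj_apply_basis, proj_apply_basis, hperm, neg_one_pow_eq_ite, neg_one_pow_eq_ite]
  simp only [heven]

theorem finite_range_proj [Finite X] : (Set.range (proj hS b)).Finite := by
  classical
  let signedPerm (w : Set.range (proj hS b)) : Equiv.Perm X × (X → Prop) :=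
    (perm hS (Set.rangeSplitting _ w),
      fun z => Even ((exponents hS (Set.rangeSplitting _ w)).count z))
  refine Set.finite_coe_iff.1 (Finite.of_injective signedPerm fun w w' h => Subtype.ext ?_)
  rw [← Set.apply_rangeSplitting (proj hS b) w, ← Set.apply_rangeSplitting (proj hS b) w']
  exact proj_eq_of_perm_eq_of_even_count_iff hS b (congrArg Prod.fst h)
    fun z => iff_of_eq (congrFun (congrArg Prod.snd h) z)

theorem closure_range_proj : Subgroup.closure (Set.range (proj hS b)) = ⊤ := by
  rw [← top_le_iff, ← MonoidHom.range_eq_top.2 (psi hS b).rangeRestrict_surjective,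
    MonoidHom.range_eq_map, ← PresentedGroup.closure_range_of, MonoidHom.map_closure]
  refine Subgroup.closure_mono ?_
  rintro _ ⟨_, ⟨x, rfl⟩, rfl⟩
  exact ⟨gen S x, rfl⟩

theorem proj_surjective [Finite X] : Surjective (proj hS b) :=
  surjective_of_finite_range_of_closure_range_eq_top (finite_range_proj hS b)
    (closure_range_proj hS b)

theorem finite_WGroup [Finite X] : Finite (WGroup hS b) :=
  Set.finite_univ_iff.1 ((proj_surjective hS b).range_eq ▸ finite_range_proj hS b)

theorem isGeneratingGeneratedGroupVia [Finite X] {Δ : StructureMonoid S}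
    (h : IsTheGarsideElement Δ) :
    IsGeneratingGeneratedGroupVia (psiSet hS b) (proj hS b Δ) (StructureMonoid S) := by
  have := Fintype.ofFinite X
  have := isCancelMul hS
  have := finite_WGroup hS b
  have hΔ := (isTheGarsideElement_iff hS).1 h
  exact (isUniqueShortestLift_of_nodup_exponents hS b (hΔ ▸ Finset.univ.nodup)
    ).isGeneratingGeneratedGroupVia (isAdditiveLength_card_exponents hS) (proj_surjective hS b)
      h.isGarside (leftDivides_mk_of_monoidRel hS hΔ)

end Representation

end StructureMonoid

end YangBaxter

end

theorem mainTheorem1 {X : Type*} [Finite X] (S : X × X → X × X)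
    (hS : YangBaxter.IsNondegenerateSymmetric S)
    {V : Type*} [AddCommGroup V] [Module ℝ V] (b : Module.Basis X ℝ V) :
    Finite (YangBaxter.WGroup hS b) ∧
    Function.Surjective (YangBaxter.toW hS b) ∧
    YangBaxter.IsGeneratingGeneratedGroup (YangBaxter.psiSet hS b)
      (YangBaxter.StructureMonoid S) ∧
    (∃! Δ : YangBaxter.StructureMonoid S, YangBaxter.IsTheGarsideElement Δ) ∧
    ∀ Δ : YangBaxter.StructureMonoid S, YangBaxter.IsTheGarsideElement Δ →
      YangBaxter.IsGeneratingGeneratedGroupVia (YangBaxter.psiSet hS b)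
        (YangBaxter.toW hS b (YangBaxter.monoidToGroup S Δ)) (YangBaxter.StructureMonoid S) := by
  have hunique := YangBaxter.StructureMonoid.existsUnique_isTheGarsideElement hS
  have hvia {Δ : YangBaxter.StructureMonoid S} (hΔ : YangBaxter.IsTheGarsideElement Δ) :
      YangBaxter.IsGeneratingGeneratedGroupVia (YangBaxter.psiSet hS b)
        (YangBaxter.toW hS b (YangBaxter.monoidToGroup S Δ)) (YangBaxter.StructureMonoid S) :=
    YangBaxter.StructureMonoid.isGeneratingGeneratedGroupVia hS b hΔ
  obtain ⟨Δ, hΔ⟩ := hunique.exists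
  exact ⟨YangBaxter.StructureMonoid.finite_WGroup hS b,
    (YangBaxter.psi hS b).rangeRestrict_surjective, ⟨_, hvia hΔ⟩, hunique, fun _ => hvia⟩
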